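/- Let $\mathbb{H}$ be the real quaternions and $\mathbb{H}[z]$ the ring of polynomials in one variable $z$ commuting with the coefficients. For $f(z)=\sum_k z^kf_k\in\mathbb{H}[z]$ and $\alpha\in\mathbb{H}$ put $f^{e_\ell}(\alpha)=\sum_k\alpha^kf_k$ and $f^{e_r}(\alpha)=\sum_k f_k\alpha^k$. Write $\alpha\sim\beta$ if $\alpha=q^{-1}\beta q$ for some nonzero $q\in\mathbb{H}$. For a finite set $S\subset\mathbb{H}$ let $\mathbb{I}_{S,\ell}$ (resp. $\mathbb{I}_{S,r}$) be the right (resp. left) ideal of all $f\in\mathbb{H}[z]$ with $f^{e_\ell}(\alpha)=0$ (resp. $f^{e_r}(\alpha)=0$) for all $\alpha\in S$, and let $P_{S,\ell}$ (resp. $P_{S,r}$) be its unique monic generator, so that $\mathbb{I}_{S,\ell}=P_{S,\ell}\,\mathbb{H}[z]$ and $\mathbb{I}_{S,r}=\mathbb{H}[z]\,P_{S,r}$. For non-real $\alpha\sim\beta$, write $\alpha=x+yI$, $\beta=x+yJ$ with $x\in\mathbb{R}$, $y>0$ and $I,J$ purely imaginary of absolute value $1$, and let $\Pi_{\alpha,\beta}$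 be the real plane $\mathrm{span}_{\mathbb{R}}\{1,I\}$ if $\beta=\alpha$, the orthogonal complement $(\mathrm{span}_{\mathbb{R}}\{1,I\})^{\perp}$ in $\mathbb{H}\cong\mathbb{R}^4$ if $\beta=\overline{\alpha}$, and $\mathrm{span}_{\mathbb{R}}\{I+J,\,1-IJ\}$ otherwise. Theorem. Let $\Lambda=\{\alpha_1,\dots,\alpha_n\}$ and $\Omega=\{\beta_1,\dots,\beta_m\}$ be two finite (possibly empty, not necessarily disjoint) sets of quaternions, with the $\alpha_i$ distinct and the $\beta_j$ distinct. Assume that $\Omega\cap\mathbb{R}=\emptyset$, that no three distinct elements of $\Lambda\cup\Omega$ are equivalent, and that, for some $0\le k\le\min(n,m)$, the equivalent pairs in $\Lambda\times\Omega$ are exactly $(\alpha_i,\beta_i)$, $i=1,\dots,k$; that is, $\alpha_i\sim\beta_j$ if and only if $i=j\le k$. For $i=1,\dots,k$ put $\Lambda_i=\Lambda\setminus\{\alpha_i\}$ and $\Omega_i=\Omega\setminus\{\beta_i\}$. Then $P_{\Lambda_i,\ell}^{e_\ell}(\alpha_i)\ne0$ and $P_{\Omega_i,r}^{e_r}(\beta_i)\neq0$,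 so that $$\widetilde\alpha_i=P_{\Lambda_i,\ell}^{e_\ell}(\alpha_i)^{-1}\,\alpha_i\,P_{\Lambda_i,\ell}^{e_\ell}(\alpha_i),\qquad \widetilde\beta_i=P_{\Omega_i,r}^{e_r}(\beta_i)\,\beta_i\,P_{\Omega_i,r}^{e_r}(\beta_i)^{-1}$$ are well defined, and $\widetilde\alpha_i\sim\alpha_i\sim\beta_i\sim\widetilde\beta_i$. Moreover, a polynomial $f\in\mathbb{H}[z]$ belongs to $\mathbb{I}_{\Lambda,\ell}\cap\mathbb{I}_{\Omega,r}$ if and only if it is of the form $$f(z)=\sum_{i=1}^kP_{\Lambda,\ell}(z)\,\mu_i\,P_{\Omega_i,r}(z)+P_{\Lambda,\ell}(z)\,h(z)\,P_{\Omega,r}(z)$$ for some $h\in\mathbb{H}[z]$ and some $\mu_i\in\Pi_{\widetilde\alpha_i,\widetilde\beta_i}$ $(i=1,\dots,k)$. -/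

import Mathlib

open scoped Quaternion

noncomputable section

namespace QuatPoly

open Polynomial

/-- Left evaluation `∑ αᵏ fₖ` of a quaternionic polynomial. -/
def leftEval (α : ℍ[ℝ]) (f : Polynomial ℍ[ℝ]) : ℍ[ℝ] :=
  f.sum fun k c => α ^ k * c

/-- Right evaluation `∑ fₖ αᵏ` of a quaternionic polynomial. -/
def rightEval (α : ℍ[ℝ]) (f : Polynomial ℍ[ℝ]) : ℍ[ℝ] :=
  f.sum fun k c => c * α ^ k

/-- All polynomials whose left zero set contains `S` (a right ideal). -/
def leftIdeal (S : Set ℍ[ℝ]) : Set (Polynomial ℍ[ℝ]) :=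
  {f | ∀ α ∈ S, leftEval α f = 0}

/-- All polynomials whose right zero set contains `S` (a left ideal). -/
def rightIdeal (S : Set ℍ[ℝ]) : Set (Polynomial ℍ[ℝ]) :=
  {f | ∀ α ∈ S, rightEval α f = 0}

/-- `p` is monic and generates the right ideal of polynomials left-vanishing on `S`. -/
def IsLeftMinPoly (S : Set ℍ[ℝ]) (p : Polynomial ℍ[ℝ]) : Prop :=
  p.Monic ∧ ∀ f, f ∈ leftIdeal S ↔ ∃ h, f = p * h

/-- `p` is monic and generates the left ideal of polynomials right-vanishing on `S`. -/
def IsRightMinPoly (S : Set ℍ[ℝ]) (p : Polynomial ℍ[ℝ]) : Prop :=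
  p.Monic ∧ ∀ f, f ∈ rightIdeal S ↔ ∃ h, f = h * p

open Classical in
/-- The left minimal polynomial of `S` (the value is `0` if the ideal has no monic generator,
which never happens for finite `S`, see `leftMinPoly_spec`). -/
def leftMinPoly (S : Set ℍ[ℝ]) : Polynomial ℍ[ℝ] :=
  if h : ∃ p, IsLeftMinPoly S p then h.choose else 0

open Classical in
/-- The right minimal polynomial of `S` (the value is `0` if the ideal has no monic generator,
which never happens for finite `S`, see `rightMinPoly_spec`). -/
def rightMinPoly (S : Set ℍ[ℝ]) : Polynomial ℍ[ℝ] :=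
  if h : ∃ p, IsRightMinPoly S p then h.choose else 0

/-- `P(α)⁻¹ α P(α)`, where `P` is the left minimal polynomial of `S \ {α}` and `P(α)` its left
value at `α`. -/
def leftTilde (S : Set ℍ[ℝ]) (α : ℍ[ℝ]) : ℍ[ℝ] :=
  (leftEval α (leftMinPoly (S \ {α})))⁻¹ * α * leftEval α (leftMinPoly (S \ {α}))

/-- `P(β) β P(β)⁻¹`, where `P` is the right minimal polynomial of `S \ {β}` and `P(β)` its right
value at `β`. -/
def rightTilde (S : Set ℍ[ℝ]) (β : ℍ[ℝ]) : ℍ[ℝ] :=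
  rightEval β (rightMinPoly (S \ {β})) * β * (rightEval β (rightMinPoly (S \ {β})))⁻¹

/-- The imaginary unit `I` of a non-real quaternion `α = x + y I`, `y > 0`. -/
def imUnit (α : ℍ[ℝ]) : ℍ[ℝ] := ‖α.im‖⁻¹ • α.im

open Classical in
/-- The real plane attached to two conjugate non-real quaternions `α = x + y I`, `β = x + y J`;
the orthogonal complement is with respect to the Euclidean metric of `ℍ ≅ ℝ⁴`. -/
def plane (α β : ℍ[ℝ]) : Submodule ℝ ℍ[ℝ] :=
  if β = α then Submodule.span ℝ {1, imUnit α}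
  else if β = star α then (Submodule.span ℝ {1, imUnit α})ᗮ
  else Submodule.span ℝ {imUnit α + imUnit β, 1 - imUnit α * imUnit β}

/-! Existence and uniqueness of the minimal polynomials of a finite set. -/

theorem leftEval_add (a : ℍ[ℝ]) (f g : Polynomial ℍ[ℝ]) :
    leftEval a (f + g) = leftEval a f + leftEval a g := by
  unfold leftEval
  exact Polynomial.sum_add_index f g _ (by simp) (by intro i x y; rw [mul_add])

theorem rightEval_eq (a : ℍ[ℝ]) (f : Polynomial ℍ[ℝ]) : rightEval a f = f.eval a := by
  rw [Polynomial.eval_eq_sum]; rfl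

theorem leftEval_monomial (a : ℍ[ℝ]) (k : ℕ) (c : ℍ[ℝ]) :
    leftEval a (monomial k c) = a ^ k * c := by
  unfold leftEval
  exact Polynomial.sum_monomial_index c _ (by simp)

theorem leftEval_mul_monomial (a : ℍ[ℝ]) (p : Polynomial ℍ[ℝ]) (k : ℕ) (c : ℍ[ℝ]) :
    leftEval a (p * monomial k c) = a ^ k * leftEval a p * c := by
  induction p using Polynomial.induction_on' with
  | add p q hp hq => rw [add_mul, leftEval_add, hp, hq, leftEval_add]; simp only [mul_add, add_mul]
  | monomial j d =>
    rw [monomial_mul_monomial, leftEval_monomial, leftEval_monomial, add_comm, pow_add]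
    simp only [mul_assoc]

theorem rightEval_monomial_mul (a : ℍ[ℝ]) (p : Polynomial ℍ[ℝ]) (k : ℕ) (c : ℍ[ℝ]) :
    rightEval a (monomial k c * p) = c * rightEval a p * a ^ k := by
  simp only [rightEval_eq]
  induction p using Polynomial.induction_on' with
  | add p q hp hq => rw [mul_add, eval_add, hp, hq, eval_add]; simp only [mul_add, add_mul]
  | monomial j d =>
    rw [monomial_mul_monomial, eval_monomial, eval_monomial, add_comm, pow_add]
    simp only [mul_assoc]

theorem leftEval_mul (a c : ℍ[ℝ]) (p h : Polynomial ℍ[ℝ])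
    (hc : a * leftEval a p = leftEval a p * c) :
    leftEval a (p * h) = leftEval a p * leftEval c h := by
  induction h using Polynomial.induction_on' with
  | add f g hf hg => rw [mul_add, leftEval_add, hf, hg, leftEval_add, mul_add]
  | monomial k d =>
    have h1 : SemiconjBy (leftEval a p) (c ^ k) (a ^ k) :=
      SemiconjBy.pow_right (show SemiconjBy (leftEval a p) c a from hc.symm) k
    rw [leftEval_mul_monomial, leftEval_monomial, ← h1.eq, mul_assoc]

theorem rightEval_mul (a c : ℍ[ℝ]) (p h : Polynomial ℍ[ℝ])
    (hc : rightEval a p * a = c * rightEval a p) :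
    rightEval a (h * p) = rightEval c h * rightEval a p := by
  induction h using Polynomial.induction_on' with
  | add f g hf hg =>
    rw [add_mul, rightEval_eq, eval_add, ← rightEval_eq, ← rightEval_eq, hf, hg,
      rightEval_eq c (f + g), eval_add, ← rightEval_eq, ← rightEval_eq, add_mul]
  | monomial k d =>
    have h1 : SemiconjBy (rightEval a p) (a ^ k) (c ^ k) :=
      SemiconjBy.pow_right (show SemiconjBy (rightEval a p) a c from hc) k
    rw [rightEval_monomial_mul, rightEval_eq c, eval_monomial, mul_assoc, h1.eq, mul_assoc]

theorem exists_left_quotient (c : ℍ[ℝ]) (h : Polynomial ℍ[ℝ]) :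
    ∃ q, h = C (leftEval c h) + (X - C c) * q := by
  induction h using Polynomial.induction_on' with
  | add f g hf hg =>
    obtain ⟨q, hq⟩ := hf
    obtain ⟨r, hr⟩ := hg
    refine ⟨q + r, ?_⟩
    rw [leftEval_add, C_add, mul_add]
    nth_rewrite 1 [hq, hr]
    abel
  | monomial k d =>
    obtain ⟨q, hq⟩ := (commute_X (C c)).sub_dvd_pow_sub_pow k
    refine ⟨q * C d, ?_⟩
    rw [← mul_assoc, ← hq, leftEval_monomial, sub_mul, C_mul, C_pow, ← C_mul_X_pow_eq_monomial,
      X_pow_mul_C]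
    abel

theorem exists_right_quotient (c : ℍ[ℝ]) (h : Polynomial ℍ[ℝ]) :
    ∃ q, h = C (rightEval c h) + q * (X - C c) := by
  induction h using Polynomial.induction_on' with
  | add f g hf hg =>
    obtain ⟨q, hq⟩ := hf
    obtain ⟨r, hr⟩ := hg
    refine ⟨q + r, ?_⟩
    rw [rightEval_eq, eval_add, ← rightEval_eq, ← rightEval_eq, C_add, add_mul]
    nth_rewrite 1 [hq, hr]
    abel
  | monomial k d =>
    have hq := (commute_X (C c)).geom_sum₂_mul k
    refine ⟨C d * ∑ i ∈ Finset.range k, X ^ i * (C c) ^ (k - 1 - i), ?_⟩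
    rw [mul_assoc, hq, rightEval_eq, eval_monomial, mul_sub, C_mul, C_pow,
      ← C_mul_X_pow_eq_monomial]
    abel

theorem leftEval_linear_mul (c : ℍ[ℝ]) (h : Polynomial ℍ[ℝ]) :
    leftEval c ((X - C c) * h) = 0 := by
  have h0 : leftEval c (X - C c) = 0 := by
    have : (X - C c : Polynomial ℍ[ℝ]) = monomial 1 1 + monomial 0 (-c) := by
      rw [monomial_zero_left, C_neg, sub_eq_add_neg]; rfl
    rw [this, leftEval_add, leftEval_monomial, leftEval_monomial]; simp
  rw [leftEval_mul c c _ h (by simp [h0]), h0, zero_mul]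

theorem rightEval_mul_linear (c : ℍ[ℝ]) (h : Polynomial ℍ[ℝ]) :
    rightEval c (h * (X - C c)) = 0 := by
  have h0 : rightEval c (X - C c) = 0 := by simp [rightEval_eq]
  rw [rightEval_mul c c _ h (by simp [h0]), h0, mul_zero]

theorem exists_leftMinPoly {S : Set ℍ[ℝ]} (hS : S.Finite) : ∃ p, IsLeftMinPoly S p := by
  induction S, hS using Set.Finite.induction_on with
  | empty => exact ⟨1, monic_one, fun f => ⟨fun _ => ⟨f, (one_mul f).symm⟩, fun _ a ha => ha.elim⟩⟩
  | @insert a S _ _ ih =>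
    obtain ⟨p, hp, hI⟩ := ih
    have hins : ∀ f, f ∈ leftIdeal (insert a S) ↔ leftEval a f = 0 ∧ f ∈ leftIdeal S := by
      intro f; simp [leftIdeal]
    by_cases h0 : leftEval a p = 0
    · refine ⟨p, hp, fun f => ?_⟩
      rw [hins, hI, and_iff_right_iff_imp]
      rintro ⟨h, rfl⟩
      rw [leftEval_mul a a p h (by simp [h0]), h0, zero_mul]
    · set c := (leftEval a p)⁻¹ * a * leftEval a p with hc
      have hac : a * leftEval a p = leftEval a p * c := by
        rw [hc, mul_assoc, mul_inv_cancel_left₀ h0]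
      refine ⟨p * (X - C c), hp.mul (monic_X_sub_C c), fun f => ?_⟩
      rw [hins, hI]
      constructor
      · rintro ⟨h1, h, rfl⟩
        rw [leftEval_mul a c p h hac] at h1
        obtain ⟨q, hq⟩ := exists_left_quotient c h
        rw [(mul_eq_zero.mp h1).resolve_left h0, C_0, zero_add] at hq
        exact ⟨q, by rw [mul_assoc, ← hq]⟩
      · rintro ⟨h, rfl⟩
        rw [mul_assoc]
        exact ⟨by rw [leftEval_mul a c p _ hac, leftEval_linear_mul, mul_zero], _, rfl⟩

theorem exists_rightMinPoly {S : Set ℍ[ℝ]} (hS : S.Finite) : ∃ p, IsRightMinPoly S p := by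
  induction S, hS using Set.Finite.induction_on with
  | empty => exact ⟨1, monic_one, fun f => ⟨fun _ => ⟨f, (mul_one f).symm⟩, fun _ a ha => ha.elim⟩⟩
  | @insert a S _ _ ih =>
    obtain ⟨p, hp, hI⟩ := ih
    have hins : ∀ f, f ∈ rightIdeal (insert a S) ↔ rightEval a f = 0 ∧ f ∈ rightIdeal S := by
      intro f; simp [rightIdeal]
    by_cases h0 : rightEval a p = 0
    · refine ⟨p, hp, fun f => ?_⟩
      rw [hins, hI, and_iff_right_iff_imp]
      rintro ⟨h, rfl⟩
      rw [rightEval_mul a a p h (by simp [h0]), h0, mul_zero]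
    · set c := rightEval a p * a * (rightEval a p)⁻¹ with hc
      have hac : rightEval a p * a = c * rightEval a p := by
        rw [hc, inv_mul_cancel_right₀ h0]
      refine ⟨(X - C c) * p, (monic_X_sub_C c).mul hp, fun f => ?_⟩
      rw [hins, hI]
      constructor
      · rintro ⟨h1, h, rfl⟩
        rw [rightEval_mul a c p h hac] at h1
        obtain ⟨q, hq⟩ := exists_right_quotient c h
        rw [(mul_eq_zero.mp h1).resolve_right h0, C_0, zero_add] at hq
        exact ⟨q, by rw [← mul_assoc, ← hq]⟩
      · rintro ⟨h, rfl⟩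
        rw [← mul_assoc]
        exact ⟨by rw [rightEval_mul a c p _ hac, rightEval_mul_linear, zero_mul], _, rfl⟩

theorem leftMinPoly_spec {S : Set ℍ[ℝ]} (hS : S.Finite) : IsLeftMinPoly S (leftMinPoly S) := by
  rw [leftMinPoly, dif_pos (exists_leftMinPoly hS)]
  exact (exists_leftMinPoly hS).choose_spec

theorem rightMinPoly_spec {S : Set ℍ[ℝ]} (hS : S.Finite) :
    IsRightMinPoly S (rightMinPoly S) := by
  rw [rightMinPoly, dif_pos (exists_rightMinPoly hS)]
  exact (exists_rightMinPoly hS).choose_spec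

theorem IsLeftMinPoly.unique {S : Set ℍ[ℝ]} {p q : Polynomial ℍ[ℝ]}
    (hp : IsLeftMinPoly S p) (hq : IsLeftMinPoly S q) : p = q := by
  obtain ⟨h, hh⟩ := (hp.2 q).1 ((hq.2 q).2 ⟨1, (mul_one q).symm⟩)
  obtain ⟨g, hg⟩ := (hq.2 p).1 ((hp.2 p).2 ⟨1, (mul_one p).symm⟩)
  have hhm : h.Monic := hp.1.of_mul_monic_left (hh ▸ hq.1)
  have hgm : g.Monic := hq.1.of_mul_monic_left (hg ▸ hp.1)
  have h1 : q.natDegree = p.natDegree + h.natDegree := by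
    rw [← hp.1.natDegree_mul hhm, ← hh]
  have h2 : p.natDegree = q.natDegree + g.natDegree := by
    rw [← hq.1.natDegree_mul hgm, ← hg]
  have h3 : h = 1 := hhm.natDegree_eq_zero.1 (by omega)
  rw [hh, h3, mul_one]

theorem IsRightMinPoly.unique {S : Set ℍ[ℝ]} {p q : Polynomial ℍ[ℝ]}
    (hp : IsRightMinPoly S p) (hq : IsRightMinPoly S q) : p = q := by
  obtain ⟨h, hh⟩ := (hp.2 q).1 ((hq.2 q).2 ⟨1, (one_mul q).symm⟩)
  obtain ⟨g, hg⟩ := (hq.2 p).1 ((hp.2 p).2 ⟨1, (one_mul p).symm⟩)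
  have hhm : h.Monic := hp.1.of_mul_monic_right (hh ▸ hq.1)
  have hgm : g.Monic := hq.1.of_mul_monic_right (hg ▸ hp.1)
  have h1 : q.natDegree = h.natDegree + p.natDegree := by
    rw [← hhm.natDegree_mul hp.1, ← hh]
  have h2 : p.natDegree = g.natDegree + q.natDegree := by
    rw [← hgm.natDegree_mul hq.1, ← hg]
  have h3 : h = 1 := hhm.natDegree_eq_zero.1 (by omega)
  rw [hh, h3, one_mul]

end QuatPoly

end

namespace QuatPoly

open Polynomial

/-! Write `P` for the left minimal polynomial of `Λ`. Left vanishing on `Λ` means f = P g, so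
everything rests on when P g vanishes from the right at a node b of `Ω`. By the product rule this
happens iff g(b) = 0 or the conjugate c = g(b) b g(b)⁻¹ is a right zero of P. Right zeros of P are
conjugate to elements of `Λ`, so an unpaired b forces g(b) = 0
(`rightEval_eq_zero_of_leftMinPoly_mul`). At b = β_i, factor P = P_{Λ_i} (z - α̃_i). If c ≠ α̃_i,
then P_{Λ_i} would have a right zero conjugate to b, which is impossible. Hence the condition is
α̃_i g(b) = g(b) b (`rightEval_leftMinPoly_mul_eq_zero_iff`).

Put g(β_i) = μ_i r with r the right value of P_{Ω_i} at β_i. Since r β_i = β̃_i r, the condition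
becomes α̃_i μ_i = μ_i β̃_i, and the solutions of this equation form the stated plane
(`mem_plane_iff`). Lagrange interpolation with the polynomials P_{Ω_i} then determines g up to a
left multiple of P_Ω. -/

/-! ### Conjugacy invariants. -/

theorem re_mul_comm (a b : ℍ[ℝ]) : (a * b).re = (b * a).re := by
  simp only [Quaternion.re_mul]; ring

theorem re_eq_of_isConj {a b : ℍ[ℝ]} (h : IsConj a b) : a.re = b.re := by
  obtain ⟨u, hu⟩ := h
  have h1 : b = u * a * (↑u⁻¹ : ℍ[ℝ]) := by
    rw [hu.eq, mul_assoc, Units.mul_inv, mul_one]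
  rw [h1, re_mul_comm, ← mul_assoc, Units.inv_mul, one_mul]

theorem norm_eq_of_isConj {a b : ℍ[ℝ]} (h : IsConj a b) : ‖a‖ = ‖b‖ := by
  obtain ⟨u, hu⟩ := h
  have h1 := congrArg norm hu.eq
  rw [norm_mul, norm_mul, mul_comm] at h1
  exact mul_right_cancel₀ (norm_ne_zero_iff.2 u.ne_zero) h1

theorem norm_sq_eq (a : ℍ[ℝ]) : ‖a‖ ^ 2 = a.re ^ 2 + a.imI ^ 2 + a.imJ ^ 2 + a.imK ^ 2 := by
  rw [sq, ← Quaternion.normSq_eq_norm_mul_self, Quaternion.normSq_def']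

theorem norm_im_eq_of_isConj {a b : ℍ[ℝ]} (h : IsConj a b) : ‖a.im‖ = ‖b.im‖ := by
  have h1 := re_eq_of_isConj h
  have h2 := congrArg (· ^ 2) (norm_eq_of_isConj h)
  simp only [norm_sq_eq, h1] at h2
  rw [← sq_eq_sq₀ (norm_nonneg _) (norm_nonneg _), norm_sq_eq, norm_sq_eq]
  simp only [Quaternion.re_im, Quaternion.imI_im, Quaternion.imJ_im, Quaternion.imK_im]
  linarith

theorem isConj_of_semiconj {a b c : ℍ[ℝ]} (hc : c ≠ 0) (h : c * a = b * c) : IsConj a b :=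
  ⟨Units.mk0 c hc, h⟩

/-! Linear equations `I μ = μ J` for imaginary units. -/

theorem re_imUnit (a : ℍ[ℝ]) : (imUnit a).re = 0 := by simp [imUnit]

theorem norm_imUnit {a : ℍ[ℝ]} (h : a.im ≠ 0) : ‖imUnit a‖ = 1 := by
  rw [imUnit, norm_smul, norm_inv, norm_norm, inv_mul_cancel₀ (norm_ne_zero_iff.2 h)]

theorem norm_im_smul_imUnit {a : ℍ[ℝ]} (h : a.im ≠ 0) : ‖a.im‖ • imUnit a = a.im := by
  rw [imUnit, smul_smul, mul_inv_cancel₀ (norm_ne_zero_iff.2 h), one_smul]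

theorem mul_self_of_unit {I : ℍ[ℝ]} (h0 : I.re = 0) (h1 : ‖I‖ = 1) : I * I = -1 := by
  have h2 := norm_sq_eq I
  rw [h1, h0] at h2
  ext <;> simp [h0] <;> linarith

theorem commute_unit_iff {I : ℍ[ℝ]} (h0 : I.re = 0) (h1 : ‖I‖ = 1) (μ : ℍ[ℝ]) :
    μ ∈ Submodule.span ℝ {1, I} ↔ I * μ = μ * I := by
  rw [Submodule.mem_span_pair]
  constructor
  · rintro ⟨a, b, rfl⟩
    simp [mul_add, add_mul]
  · intro h
    have h2 := norm_sq_eq I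
    rw [h1, h0] at h2
    simp only [Quaternion.ext_iff, Quaternion.re_mul, Quaternion.imI_mul, Quaternion.imJ_mul,
      Quaternion.imK_mul, h0] at h
    obtain ⟨-, e1, e2, e3⟩ := h
    -- The commutator of `I` and `μ` is twice the cross product of `I` with `μ.im`, so `μ.im` is its
    -- own projection onto the unit vector `I`.
    refine ⟨μ.re, μ.imI * I.imI + μ.imJ * I.imJ + μ.imK * I.imK, ?_⟩
    ext
    · simp [h0]
    · simp
      linear_combination (-μ.imI) * h2 - I.imK / 2 * e2 + I.imJ / 2 * e3
    · simp
      linear_combination (-μ.imJ) * h2 + I.imK / 2 * e1 - I.imI / 2 * e3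
    · simp
      linear_combination (-μ.imK) * h2 - I.imJ / 2 * e1 + I.imI / 2 * e2

/-- Iμ + μI = 2 re(μ) I - 2⟨I, μ⟩, whose imaginary and real parts vanish exactly when μ is
orthogonal to 1 and to I. -/
theorem anticommute_unit_iff {I : ℍ[ℝ]} (h0 : I.re = 0) (h1 : ‖I‖ = 1) (μ : ℍ[ℝ]) :
    μ ∈ (Submodule.span ℝ {1, I})ᗮ ↔ I * μ = μ * -I := by
  have h2 := norm_sq_eq I
  rw [h1, h0] at h2
  have h3 : μ ∈ (Submodule.span ℝ {1, I})ᗮ ↔ inner ℝ 1 μ = 0 ∧ inner ℝ I μ = 0 := by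
    rw [Submodule.mem_orthogonal]
    constructor
    · intro h
      exact ⟨h _ (Submodule.subset_span (by simp)), h _ (Submodule.subset_span (by simp))⟩
    · rintro ⟨ha, hb⟩ u hu
      obtain ⟨a, b, rfl⟩ := Submodule.mem_span_pair.1 hu
      rw [inner_add_left, real_inner_smul_left, real_inner_smul_left, ha, hb]
      ring
  rw [h3, Quaternion.inner_def, Quaternion.inner_def]
  simp only [Quaternion.ext_iff, Quaternion.re_mul, Quaternion.imI_mul, Quaternion.imJ_mul,
    Quaternion.imK_mul, h0, Quaternion.re_star, Quaternion.imI_star, Quaternion.imJ_star,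
    Quaternion.imK_star, Quaternion.re_neg, Quaternion.imI_neg, Quaternion.imJ_neg,
    Quaternion.imK_neg, one_mul]
  constructor
  · rintro ⟨ha, hb⟩
    rw [ha]
    refine ⟨?_, ?_, ?_, ?_⟩ <;> linarith
  · rintro ⟨e0, e1, e2, e3⟩
    constructor
    · linear_combination μ.re * h2 + I.imI / 2 * e1 + I.imJ / 2 * e2 + I.imK / 2 * e3
    · linarith

/-- I + J is itself a solution, and it is invertible, so dividing by it on the right carries every
solution into the centralizer span{1, I} of I. -/
theorem semiconj_units_iff {I J : ℍ[ℝ]} (hI : I.re = 0) (hI' : ‖I‖ = 1) (hJ : J.re = 0)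
    (hJ' : ‖J‖ = 1) (hne : I + J ≠ 0) (μ : ℍ[ℝ]) :
    μ ∈ Submodule.span ℝ {I + J, 1 - I * J} ↔ I * μ = μ * J := by
  have hII := mul_self_of_unit hI hI'
  have hJJ := mul_self_of_unit hJ hJ'
  have e1 : I * (I + J) = (I + J) * J := by rw [mul_add, add_mul, hII, hJJ, add_comm]
  have e2 : I * (1 - I * J) = (1 - I * J) * J := by
    rw [mul_sub, sub_mul, ← mul_assoc, hII, mul_assoc, hJJ]
    simp [add_comm]
  constructor
  · intro h
    obtain ⟨a, b, rfl⟩ := Submodule.mem_span_pair.1 h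
    rw [mul_add, add_mul, mul_smul_comm, mul_smul_comm, smul_mul_assoc, smul_mul_assoc, e1, e2]
  · intro h
    have e3 : J * (I + J)⁻¹ = (I + J)⁻¹ * I := by
      rw [eq_inv_mul_iff_mul_eq₀ hne, ← mul_assoc, ← e1, mul_inv_cancel_right₀ hne]
    have h4 : I * (μ * (I + J)⁻¹) = μ * (I + J)⁻¹ * I := by
      rw [← mul_assoc, h, mul_assoc, e3, mul_assoc]
    obtain ⟨a, b, hab⟩ := Submodule.mem_span_pair.1 ((commute_unit_iff hI hI' _).2 h4)
    -- The sign appears because I(I + J) = -(1 - IJ).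
    refine Submodule.mem_span_pair.2 ⟨a, -b, ?_⟩
    have h5 : μ = μ * (I + J)⁻¹ * (I + J) := by rw [inv_mul_cancel_right₀ hne]
    rw [h5, ← hab, add_mul, smul_mul_assoc, smul_mul_assoc, mul_add I, hII, one_mul]
    module

/-- The plane attached to two conjugate non-real quaternions consists of their intertwiners. -/
theorem mem_plane_iff {a b : ℍ[ℝ]} (hab : IsConj a b) (ha : a.im ≠ 0) (μ : ℍ[ℝ]) :
    μ ∈ plane a b ↔ a * μ = μ * b := by
  have hre := re_eq_of_isConj hab
  have hn := norm_im_eq_of_isConj hab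
  have hy := norm_ne_zero_iff.2 ha
  have hb : b.im ≠ 0 := norm_ne_zero_iff.1 (hn ▸ hy)
  have ea : a = (a.re : ℍ[ℝ]) + ‖a.im‖ • imUnit a := by
    rw [norm_im_smul_imUnit ha, Quaternion.re_add_im]
  have eb : b = (a.re : ℍ[ℝ]) + ‖a.im‖ • imUnit b := by
    rw [hn, norm_im_smul_imUnit hb, hre, Quaternion.re_add_im]
  -- Conjugates share the real part, which is central, and the norm of the imaginary part; both
  -- cancel.
  have key : a * μ = μ * b ↔ imUnit a * μ = μ * imUnit b := by
    have e1 : a * μ = (a.re : ℍ[ℝ]) * μ + ‖a.im‖ • (imUnit a * μ) := by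
      rw [← smul_mul_assoc, ← add_mul, ← ea]
    have e2 : μ * b = (a.re : ℍ[ℝ]) * μ + ‖a.im‖ • (μ * imUnit b) := by
      rw [← mul_smul_comm, Quaternion.coe_commutes, ← mul_add, ← eb]
    rw [e1, e2, add_right_inj]
    exact (smul_right_injective ℍ[ℝ] hy).eq_iff
  rw [key, plane]
  split_ifs with h1 h2
  · rw [h1]
    exact commute_unit_iff (re_imUnit a) (norm_imUnit ha) μ
  · have h3 : imUnit b = -imUnit a := by
      have h4 : (star a).im = -a.im := by ext <;> simp
      rw [h2, imUnit, imUnit, h4, norm_neg, smul_neg]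
    rw [h3]
    exact anticommute_unit_iff (re_imUnit a) (norm_imUnit ha) μ
  · refine semiconj_units_iff (re_imUnit a) (norm_imUnit ha) (re_imUnit b) (norm_imUnit hb)
      (fun h => h2 ?_) μ
    rw [eb, eq_neg_of_add_eq_zero_right h, smul_neg, norm_im_smul_imUnit ha]
    ext <;> simp

/-! Minimal polynomials of a set with one more node. -/

theorem leftEval_one (a : ℍ[ℝ]) : leftEval a 1 = 1 := by
  have := leftEval_monomial a 0 1
  rwa [pow_zero, one_mul, monomial_zero_one] at this

theorem leftEval_X_sub_C (a c : ℍ[ℝ]) : leftEval a (X - C c) = a - c := by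
  have : (X - C c : Polynomial ℍ[ℝ]) = monomial 1 1 + monomial 0 (-c) := by
    rw [monomial_zero_left, C_neg, sub_eq_add_neg]; rfl
  rw [this, leftEval_add, leftEval_monomial, leftEval_monomial]
  simp [sub_eq_add_neg]

theorem rightEval_X_sub_C (a c : ℍ[ℝ]) : rightEval a (X - C c) = a - c := by
  simp [rightEval_eq]

theorem leftMinPoly_empty : leftMinPoly ∅ = 1 :=
  (leftMinPoly_spec Set.finite_empty).unique
    ⟨monic_one, fun f => ⟨fun _ => ⟨f, (one_mul f).symm⟩, fun _ _ ha => ha.elim⟩⟩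

theorem rightMinPoly_empty : rightMinPoly ∅ = 1 :=
  (rightMinPoly_spec Set.finite_empty).unique
    ⟨monic_one, fun f => ⟨fun _ => ⟨f, (mul_one f).symm⟩, fun _ _ ha => ha.elim⟩⟩

theorem mem_leftIdeal_insert {a : ℍ[ℝ]} {S : Set ℍ[ℝ]} {f : Polynomial ℍ[ℝ]} :
    f ∈ leftIdeal (insert a S) ↔ leftEval a f = 0 ∧ f ∈ leftIdeal S := by
  simp [leftIdeal]

theorem mem_rightIdeal_insert {a : ℍ[ℝ]} {S : Set ℍ[ℝ]} {f : Polynomial ℍ[ℝ]} :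
    f ∈ rightIdeal (insert a S) ↔ rightEval a f = 0 ∧ f ∈ rightIdeal S := by
  simp [rightIdeal]

theorem leftMinPoly_insert_of_eval_eq_zero {S : Set ℍ[ℝ]} (hS : S.Finite) {a : ℍ[ℝ]}
    (h0 : leftEval a (leftMinPoly S) = 0) : leftMinPoly (insert a S) = leftMinPoly S := by
  have hP := leftMinPoly_spec hS
  refine (leftMinPoly_spec (hS.insert a)).unique ⟨hP.1, fun f => ?_⟩
  rw [mem_leftIdeal_insert, hP.2, and_iff_right_iff_imp]
  rintro ⟨h, rfl⟩
  rw [leftEval_mul a a _ h (by simp [h0]), h0, zero_mul]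

theorem rightMinPoly_insert_of_eval_eq_zero {S : Set ℍ[ℝ]} (hS : S.Finite) {a : ℍ[ℝ]}
    (h0 : rightEval a (rightMinPoly S) = 0) : rightMinPoly (insert a S) = rightMinPoly S := by
  have hP := rightMinPoly_spec hS
  refine (rightMinPoly_spec (hS.insert a)).unique ⟨hP.1, fun f => ?_⟩
  rw [mem_rightIdeal_insert, hP.2, and_iff_right_iff_imp]
  rintro ⟨h, rfl⟩
  rw [rightEval_mul a a _ h (by simp [h0]), h0, mul_zero]

/-- The product rule moves a left zero `a` of `P h` to a left zero `c` of `h`, and that means left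
divisibility of `h` by `X - C c`. -/
theorem leftMinPoly_insert {S : Set ℍ[ℝ]} (hS : S.Finite) {a c : ℍ[ℝ]}
    (h0 : leftEval a (leftMinPoly S) ≠ 0)
    (hac : a * leftEval a (leftMinPoly S) = leftEval a (leftMinPoly S) * c) :
    leftMinPoly (insert a S) = leftMinPoly S * (X - C c) := by
  have hP := leftMinPoly_spec hS
  refine (leftMinPoly_spec (hS.insert a)).unique ⟨hP.1.mul (monic_X_sub_C c), fun f => ?_⟩
  rw [mem_leftIdeal_insert, hP.2]
  constructor
  · rintro ⟨h1, h, rfl⟩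
    rw [leftEval_mul a c _ h hac] at h1
    obtain ⟨q, hq⟩ := exists_left_quotient c h
    rw [(mul_eq_zero.mp h1).resolve_left h0, C_0, zero_add] at hq
    exact ⟨q, by rw [mul_assoc, ← hq]⟩
  · rintro ⟨h, rfl⟩
    rw [mul_assoc]
    exact ⟨by rw [leftEval_mul a c _ _ hac, leftEval_linear_mul, mul_zero], _, rfl⟩

theorem rightMinPoly_insert {S : Set ℍ[ℝ]} (hS : S.Finite) {a c : ℍ[ℝ]}
    (h0 : rightEval a (rightMinPoly S) ≠ 0)
    (hac : rightEval a (rightMinPoly S) * a = c * rightEval a (rightMinPoly S)) :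
    rightMinPoly (insert a S) = (X - C c) * rightMinPoly S := by
  have hP := rightMinPoly_spec hS
  refine (rightMinPoly_spec (hS.insert a)).unique ⟨(monic_X_sub_C c).mul hP.1, fun f => ?_⟩
  rw [mem_rightIdeal_insert, hP.2]
  constructor
  · rintro ⟨h1, h, rfl⟩
    rw [rightEval_mul a c _ h hac] at h1
    obtain ⟨q, hq⟩ := exists_right_quotient c h
    rw [(mul_eq_zero.mp h1).resolve_right h0, C_0, zero_add] at hq
    exact ⟨q, by rw [← mul_assoc, ← hq]⟩
  · rintro ⟨h, rfl⟩
    rw [← mul_assoc]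
    exact ⟨by rw [rightEval_mul a c _ _ hac, rightEval_mul_linear, zero_mul], _, rfl⟩

/-- If `p h` vanishes from the right at `a` and `h` does not, then `p` vanishes from the right at
the conjugate of `a` by `h(a)`. -/
theorem exists_semiconj_of_rightEval_mul {p h : Polynomial ℍ[ℝ]} {a : ℍ[ℝ]}
    (h0 : rightEval a h ≠ 0) (hz : rightEval a (p * h) = 0) :
    ∃ c, rightEval a h * a = c * rightEval a h ∧ IsConj a c ∧ rightEval c p = 0 := by
  have hc : rightEval a h * a =
      rightEval a h * a * (rightEval a h)⁻¹ * rightEval a h := by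
    rw [inv_mul_cancel_right₀ h0]
  rw [rightEval_mul a _ h p hc] at hz
  exact ⟨_, hc, isConj_of_semiconj h0 hc, (mul_eq_zero.1 hz).resolve_right h0⟩

theorem exists_semiconj_of_leftEval_mul {p h : Polynomial ℍ[ℝ]} {a : ℍ[ℝ]}
    (h0 : leftEval a p ≠ 0) (hz : leftEval a (p * h) = 0) :
    ∃ c, a * leftEval a p = leftEval a p * c ∧ IsConj c a ∧ leftEval c h = 0 := by
  have hc : a * leftEval a p = leftEval a p * ((leftEval a p)⁻¹ * a * leftEval a p) := by
    rw [mul_assoc, mul_inv_cancel_left₀ h0]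
  rw [leftEval_mul a _ p h hc] at hz
  exact ⟨_, hc, isConj_of_semiconj h0 hc.symm, (mul_eq_zero.1 hz).resolve_left h0⟩

/-- Every right zero of the left minimal polynomial of `S` is conjugate to an element of `S`. -/
theorem exists_isConj_of_rightEval_leftMinPoly {S : Set ℍ[ℝ]} (hS : S.Finite) :
    ∀ b, rightEval b (leftMinPoly S) = 0 → ∃ a ∈ S, IsConj a b := by
  induction S, hS using Set.Finite.induction_on with
  | empty => intro b hb; simp [leftMinPoly_empty, rightEval_eq] at hb
  | @insert a S _ hS ih =>
    intro b hb
    by_cases h0 : leftEval a (leftMinPoly S) = 0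
    · rw [leftMinPoly_insert_of_eval_eq_zero hS h0] at hb
      obtain ⟨s, hs, hsb⟩ := ih b hb
      exact ⟨s, Set.mem_insert_of_mem a hs, hsb⟩
    · have hac : a * leftEval a (leftMinPoly S) = leftEval a (leftMinPoly S) *
          ((leftEval a (leftMinPoly S))⁻¹ * a * leftEval a (leftMinPoly S)) := by
        rw [mul_assoc, mul_inv_cancel_left₀ h0]
      rw [leftMinPoly_insert hS h0 hac] at hb
      set c := (leftEval a (leftMinPoly S))⁻¹ * a * leftEval a (leftMinPoly S)
      by_cases hbc : b = c
      · exact ⟨a, Set.mem_insert a S, hbc ▸ (isConj_of_semiconj h0 hac.symm).symm⟩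
      -- A right zero other than `c` passes through the factor `X - C c` to a conjugate right zero
      -- of the smaller minimal polynomial.
      · obtain ⟨d, -, hbd, hd⟩ := exists_semiconj_of_rightEval_mul
          (by rw [rightEval_X_sub_C]; exact sub_ne_zero.2 hbc) hb
        obtain ⟨s, hs, hsd⟩ := ih d hd
        exact ⟨s, Set.mem_insert_of_mem a hs, hsd.trans hbd.symm⟩

/-- A left zero of P_S (z - c) that is not one of P_S is conjugate to c, hence to the new node. This
gives the nonvanishing of P_{Λ_i} at α_i; the right-handed version below does the same for P_{Ω_i}
at β_i. -/
theorem exists_isConj_of_leftEval_leftMinPoly {S : Set ℍ[ℝ]} (hS : S.Finite) :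
    ∀ b, leftEval b (leftMinPoly S) = 0 → ∃ a ∈ S, IsConj a b := by
  induction S, hS using Set.Finite.induction_on with
  | empty => intro b hb; simp [leftMinPoly_empty, leftEval_one] at hb
  | @insert a S _ hS ih =>
    intro b hb
    by_cases hb0 : leftEval b (leftMinPoly S) = 0
    · obtain ⟨s, hs, hsb⟩ := ih b hb0
      exact ⟨s, Set.mem_insert_of_mem a hs, hsb⟩
    by_cases h0 : leftEval a (leftMinPoly S) = 0
    · rw [leftMinPoly_insert_of_eval_eq_zero hS h0] at hb
      exact absurd hb hb0
    · have hac : a * leftEval a (leftMinPoly S) = leftEval a (leftMinPoly S) *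
          ((leftEval a (leftMinPoly S))⁻¹ * a * leftEval a (leftMinPoly S)) := by
        rw [mul_assoc, mul_inv_cancel_left₀ h0]
      rw [leftMinPoly_insert hS h0 hac] at hb
      obtain ⟨d, -, hdb, hd⟩ := exists_semiconj_of_leftEval_mul hb0 hb
      rw [leftEval_X_sub_C, sub_eq_zero] at hd
      exact ⟨a, Set.mem_insert a S,
        ((isConj_of_semiconj h0 hac.symm).symm.trans (hd ▸ IsConj.refl d)).trans hdb⟩

theorem exists_isConj_of_rightEval_rightMinPoly {S : Set ℍ[ℝ]} (hS : S.Finite) :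
    ∀ b, rightEval b (rightMinPoly S) = 0 → ∃ a ∈ S, IsConj a b := by
  induction S, hS using Set.Finite.induction_on with
  | empty => intro b hb; simp [rightMinPoly_empty, rightEval_eq] at hb
  | @insert a S _ hS ih =>
    intro b hb
    by_cases hb0 : rightEval b (rightMinPoly S) = 0
    · obtain ⟨s, hs, hsb⟩ := ih b hb0
      exact ⟨s, Set.mem_insert_of_mem a hs, hsb⟩
    by_cases h0 : rightEval a (rightMinPoly S) = 0
    · rw [rightMinPoly_insert_of_eval_eq_zero hS h0] at hb
      exact absurd hb hb0
    · have hac : rightEval a (rightMinPoly S) * a =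
          rightEval a (rightMinPoly S) * a * (rightEval a (rightMinPoly S))⁻¹ *
            rightEval a (rightMinPoly S) := by
        rw [inv_mul_cancel_right₀ h0]
      rw [rightMinPoly_insert hS h0 hac] at hb
      obtain ⟨d, -, hbd, hd⟩ := exists_semiconj_of_rightEval_mul hb0 hb
      rw [rightEval_X_sub_C, sub_eq_zero] at hd
      exact ⟨a, Set.mem_insert a S,
        ((isConj_of_semiconj h0 hac).trans (hd ▸ IsConj.refl d)).trans hbd.symm⟩

/-! Membership criteria. -/

theorem mul_leftTilde {S : Set ℍ[ℝ]} {a : ℍ[ℝ]}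
    (h0 : leftEval a (leftMinPoly (S \ {a})) ≠ 0) :
    a * leftEval a (leftMinPoly (S \ {a})) =
      leftEval a (leftMinPoly (S \ {a})) * leftTilde S a := by
  rw [leftTilde, mul_assoc, mul_inv_cancel_left₀ h0]

theorem rightTilde_mul {S : Set ℍ[ℝ]} {b : ℍ[ℝ]}
    (h0 : rightEval b (rightMinPoly (S \ {b})) ≠ 0) :
    rightEval b (rightMinPoly (S \ {b})) * b =
      rightTilde S b * rightEval b (rightMinPoly (S \ {b})) := by
  rw [rightTilde, inv_mul_cancel_right₀ h0]

theorem leftMinPoly_eq_mul {S : Set ℍ[ℝ]} (hS : S.Finite) {a : ℍ[ℝ]} (ha : a ∈ S)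
    (h0 : leftEval a (leftMinPoly (S \ {a})) ≠ 0) :
    leftMinPoly S = leftMinPoly (S \ {a}) * (X - C (leftTilde S a)) := by
  have h := leftMinPoly_insert (hS.subset Set.sdiff_subset) h0 (mul_leftTilde h0)
  rwa [Set.insert_sdiff_singleton, Set.insert_eq_of_mem ha] at h

theorem leftEval_leftMinPoly_mul {S : Set ℍ[ℝ]} (hS : S.Finite) {a : ℍ[ℝ]} (ha : a ∈ S)
    (h : Polynomial ℍ[ℝ]) : leftEval a (leftMinPoly S * h) = 0 :=
  ((leftMinPoly_spec hS).2 _).2 ⟨h, rfl⟩ a ha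

theorem rightEval_mul_rightMinPoly {S : Set ℍ[ℝ]} (hS : S.Finite) {b : ℍ[ℝ]} (hb : b ∈ S)
    (h : Polynomial ℍ[ℝ]) : rightEval b (h * rightMinPoly S) = 0 :=
  ((rightMinPoly_spec hS).2 _).2 ⟨h, rfl⟩ b hb

theorem rightEval_add (a : ℍ[ℝ]) (f g : Polynomial ℍ[ℝ]) :
    rightEval a (f + g) = rightEval a f + rightEval a g := by
  simp only [rightEval_eq, eval_add]

theorem rightEval_sub (a : ℍ[ℝ]) (f g : Polynomial ℍ[ℝ]) :
    rightEval a (f - g) = rightEval a f - rightEval a g := by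
  simp only [rightEval_eq, eval_sub]

theorem rightEval_sum {ι : Type*} (s : Finset ι) (a : ℍ[ℝ]) (f : ι → Polynomial ℍ[ℝ]) :
    rightEval a (∑ i ∈ s, f i) = ∑ i ∈ s, rightEval a (f i) := by
  simp only [rightEval_eq, eval_finsetSum]

theorem rightEval_C_mul (a c : ℍ[ℝ]) (f : Polynomial ℍ[ℝ]) :
    rightEval a (C c * f) = c * rightEval a f := by
  simp only [rightEval_eq, eval_C_mul]

/-- If no element of `S` other than `a` is conjugate to `b`, then `P g` with `P` the left minimal polynomial of `S`
vanishes from the right at `b` iff `g(b)` intertwines `b` with `leftTilde S a`. -/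
theorem rightEval_leftMinPoly_mul_eq_zero_iff {S : Set ℍ[ℝ]} (hS : S.Finite) {a b : ℍ[ℝ]}
    (ha : a ∈ S) (h0 : leftEval a (leftMinPoly (S \ {a})) ≠ 0)
    (hb : ∀ s ∈ S, IsConj s b → s = a) (g : Polynomial ℍ[ℝ]) :
    rightEval b (leftMinPoly S * g) = 0 ↔
      leftTilde S a * rightEval b g = rightEval b g * b := by
  by_cases hg : rightEval b g = 0
  · rw [rightEval_mul b b g _ (by simp [hg]), hg]
    simp
  rw [leftMinPoly_eq_mul hS ha h0]
  constructor
  · intro hz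
    obtain ⟨c, hc, hbc, hc0⟩ := exists_semiconj_of_rightEval_mul hg hz
    suffices c = leftTilde S a by rw [hc, this]
    -- Otherwise the zero passes on to the minimal polynomial of `S \ {a}`, giving a second node
    -- conjugate to `b`.
    by_contra hne
    obtain ⟨d, -, hcd, hd⟩ := exists_semiconj_of_rightEval_mul
      (by rw [rightEval_X_sub_C]; exact sub_ne_zero.2 hne) hc0
    obtain ⟨s, hs, hsd⟩ :=
      exists_isConj_of_rightEval_leftMinPoly (hS.subset Set.sdiff_subset) d hd
    exact hs.2 (hb s hs.1 ((hsd.trans hcd.symm).trans hbc.symm))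
  · intro h
    rw [rightEval_mul b _ g _ h.symm, rightEval_mul_linear, zero_mul]

theorem rightEval_eq_zero_of_leftMinPoly_mul {S : Set ℍ[ℝ]} (hS : S.Finite) {b : ℍ[ℝ]}
    (hb : ∀ s ∈ S, ¬IsConj s b) {g : Polynomial ℍ[ℝ]}
    (hz : rightEval b (leftMinPoly S * g) = 0) : rightEval b g = 0 := by
  by_contra hg
  obtain ⟨c, -, hbc, hc0⟩ := exists_semiconj_of_rightEval_mul hg hz
  obtain ⟨s, hs, hsc⟩ := exists_isConj_of_rightEval_leftMinPoly hS c hc0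
  exact hb s hs (hsc.trans hbc.symm)

end QuatPoly

/-! ### Interpolation at the nodes of `Ω` and the main equivalence. -/

theorem theoremT (n m k : ℕ) (hkn : k ≤ n) (hkm : k ≤ m)
    (α : Fin n → ℍ[ℝ]) (β : Fin m → ℍ[ℝ])
    (Λ Ω : Set ℍ[ℝ]) (hΛ : Λ = Set.range α) (hΩ : Ω = Set.range β)
    -- the listed nodes are distinct
    (hα : Function.Injective α) (hβ : Function.Injective β)
    -- real nodes are assigned to the left set
    (hreal : ∀ x : ℝ, (x : ℍ[ℝ]) ∉ Ω)
    -- no three distinct elements of the union are equivalent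
    (hthree : ∀ a ∈ Λ ∪ Ω, ∀ b ∈ Λ ∪ Ω, ∀ c ∈ Λ ∪ Ω,
      IsConj a b → IsConj a c → a = b ∨ a = c ∨ b = c)
    -- the equivalent pairs are exactly the first `k` pairs with equal indices
    (hpairs : ∀ (i : Fin n) (j : Fin m),
      IsConj (α i) (β j) ↔ (i : ℕ) = (j : ℕ) ∧ (i : ℕ) < k) :
    (∀ i : Fin k,
      QuatPoly.leftEval (α (Fin.castLE hkn i))
        (QuatPoly.leftMinPoly (Λ \ {α (Fin.castLE hkn i)})) ≠ 0 ∧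
      QuatPoly.rightEval (β (Fin.castLE hkm i))
        (QuatPoly.rightMinPoly (Ω \ {β (Fin.castLE hkm i)})) ≠ 0 ∧
      IsConj (QuatPoly.leftTilde Λ (α (Fin.castLE hkn i))) (α (Fin.castLE hkn i)) ∧
      IsConj (α (Fin.castLE hkn i)) (β (Fin.castLE hkm i)) ∧
      IsConj (β (Fin.castLE hkm i)) (QuatPoly.rightTilde Ω (β (Fin.castLE hkm i)))) ∧
    ∀ f : Polynomial ℍ[ℝ],
      f ∈ QuatPoly.leftIdeal Λ ∩ QuatPoly.rightIdeal Ω ↔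
        ∃ (μ : Fin k → ℍ[ℝ]) (h : Polynomial ℍ[ℝ]),
          (∀ i : Fin k, μ i ∈ QuatPoly.plane
            (QuatPoly.leftTilde Λ (α (Fin.castLE hkn i)))
            (QuatPoly.rightTilde Ω (β (Fin.castLE hkm i)))) ∧
          f = (∑ i : Fin k, QuatPoly.leftMinPoly Λ * Polynomial.C (μ i) *
                QuatPoly.rightMinPoly (Ω \ {β (Fin.castLE hkm i)})) +
              QuatPoly.leftMinPoly Λ * h * QuatPoly.rightMinPoly Ω := by
  have hΛf : Λ.Finite := hΛ ▸ Set.finite_range α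
  have hΩf : Ω.Finite := hΩ ▸ Set.finite_range β
  have hαm : ∀ i, α i ∈ Λ := fun i => hΛ ▸ Set.mem_range_self i
  have hβm : ∀ j, β j ∈ Ω := fun j => hΩ ▸ Set.mem_range_self j
  set A : Fin k → ℍ[ℝ] := fun i => α (Fin.castLE hkn i) with hA
  set B : Fin k → ℍ[ℝ] := fun i => β (Fin.castLE hkm i) with hB
  have hAB : ∀ i, IsConj (A i) (B i) := fun i => (hpairs _ _).2 ⟨rfl, i.2⟩
  have hAu : ∀ i, ∀ s ∈ Λ, IsConj s (B i) → s = A i := by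
    intro i s hs hc
    rw [hΛ] at hs
    obtain ⟨j, rfl⟩ := hs
    exact congrArg α (Fin.ext ((hpairs _ _).1 hc).1)
  have hBu : ∀ i, ∀ s ∈ Ω, IsConj (A i) s → s = B i := by
    intro i s hs hc
    rw [hΩ] at hs
    obtain ⟨j, rfl⟩ := hs
    exact congrArg β (Fin.ext ((hpairs _ _).1 hc).1.symm)
  have hA0 : ∀ i, QuatPoly.leftEval (A i) (QuatPoly.leftMinPoly (Λ \ {A i})) ≠ 0 := by
    intro i h
    obtain ⟨s, hs, hc⟩ := QuatPoly.exists_isConj_of_leftEval_leftMinPoly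
      (hΛf.subset Set.sdiff_subset) _ h
    exact hs.2 (hAu i s hs.1 (hc.trans (hAB i)))
  have hB0 : ∀ i, QuatPoly.rightEval (B i) (QuatPoly.rightMinPoly (Ω \ {B i})) ≠ 0 := by
    intro i h
    obtain ⟨s, hs, hc⟩ := QuatPoly.exists_isConj_of_rightEval_rightMinPoly
      (hΩf.subset Set.sdiff_subset) _ h
    exact hs.2 (hBu i s hs.1 ((hAB i).trans hc.symm))
  have hAt : ∀ i, IsConj (QuatPoly.leftTilde Λ (A i)) (A i) := fun i =>
    QuatPoly.isConj_of_semiconj (hA0 i) (QuatPoly.mul_leftTilde (hA0 i)).symm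
  have hBt : ∀ i, IsConj (B i) (QuatPoly.rightTilde Ω (B i)) := fun i =>
    QuatPoly.isConj_of_semiconj (hB0 i) (QuatPoly.rightTilde_mul (hB0 i))
  -- The criterion is applied to g = μ P_{Ω_i}, whose value at `B i` is μ r; moving `B i` across r
  -- turns it into `rightTilde Ω (B i)`, and r cancels.
  have hplane : ∀ i (μ : ℍ[ℝ]), μ ∈ QuatPoly.plane (QuatPoly.leftTilde Λ (A i))
      (QuatPoly.rightTilde Ω (B i)) ↔ QuatPoly.rightEval (B i) (QuatPoly.leftMinPoly Λ *
        (Polynomial.C μ * QuatPoly.rightMinPoly (Ω \ {B i}))) = 0 := by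
    intro i μ
    have hc := (hAt i).trans (hAB i)
    rw [QuatPoly.mem_plane_iff (hc.trans (hBt i)), QuatPoly.rightEval_leftMinPoly_mul_eq_zero_iff
      hΛf (hαm _) (hA0 i) (hAu i), QuatPoly.rightEval_C_mul, mul_assoc μ,
      QuatPoly.rightTilde_mul (hB0 i), ← mul_assoc, ← mul_assoc]
    · exact (mul_left_inj' (hB0 i)).symm
    -- The plane requires a non-real conjugacy class: a real one would make `B i` a real element of
    -- `Ω`.
    · intro h
      have h1 : (B i).im = 0 := by
        rw [← norm_eq_zero, ← QuatPoly.norm_im_eq_of_isConj hc, h, norm_zero]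
      apply hreal (B i).re
      have h2 := Quaternion.re_add_im (B i)
      rw [h1, add_zero] at h2
      rw [h2]
      exact hβm _
  refine ⟨fun i => ⟨hA0 i, hB0 i, hAt i, hAB i, hBt i⟩, fun f => ⟨?_, ?_⟩⟩
  · rintro ⟨hfl, hfr⟩
    obtain ⟨g, rfl⟩ := ((QuatPoly.leftMinPoly_spec hΛf).2 f).1 hfl
    set r : Fin k → ℍ[ℝ] := fun i =>
      QuatPoly.rightEval (B i) (QuatPoly.rightMinPoly (Ω \ {B i})) with hr
    -- Lagrange coefficients: μ_i P_{Ω_i} takes the value g(β_i) at β_i and vanishes on the rest of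
    -- `Ω`.
    set μ : Fin k → ℍ[ℝ] := fun i => QuatPoly.rightEval (B i) g * (r i)⁻¹ with hμ
    have hμr : ∀ i, QuatPoly.rightEval (B i)
        (Polynomial.C (μ i) * QuatPoly.rightMinPoly (Ω \ {B i})) = QuatPoly.rightEval (B i) g := by
      intro i
      rw [QuatPoly.rightEval_C_mul]
      exact inv_mul_cancel_right₀ (hB0 i) _
    have hdiff : g - ∑ i, Polynomial.C (μ i) * QuatPoly.rightMinPoly (Ω \ {B i}) ∈
        QuatPoly.rightIdeal Ω := by
      intro b hb
      rw [QuatPoly.rightEval_sub, QuatPoly.rightEval_sum, sub_eq_zero]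
      by_cases hbB : ∃ i, b = B i
      · obtain ⟨i, rfl⟩ := hbB
        rw [Finset.sum_eq_single i, hμr]
        · intro j _ hji
          refine QuatPoly.rightEval_mul_rightMinPoly (hΩf.subset Set.sdiff_subset)
            ⟨hb, fun h => hji ?_⟩ _
          exact (Fin.castLE_injective hkm (hβ h)).symm
        · simp
      · have hb0 : QuatPoly.rightEval b g = 0 := by
          refine QuatPoly.rightEval_eq_zero_of_leftMinPoly_mul hΛf (fun s hs hc => ?_) (hfr b hb)
          rw [hΛ] at hs
          rw [hΩ] at hb
          obtain ⟨i, rfl⟩ := hs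
          obtain ⟨j, rfl⟩ := hb
          obtain ⟨h1, h2⟩ := (hpairs i j).1 hc
          exact hbB ⟨⟨i, h2⟩, congrArg β (Fin.ext h1.symm)⟩
        rw [hb0, eq_comm]
        refine Finset.sum_eq_zero fun i _ => ?_
        exact QuatPoly.rightEval_mul_rightMinPoly (hΩf.subset Set.sdiff_subset)
          ⟨hb, fun h => hbB ⟨i, h⟩⟩ _
    obtain ⟨h, hh⟩ := ((QuatPoly.rightMinPoly_spec hΩf).2 _).1 hdiff
    refine ⟨μ, h, fun i => ?_, ?_⟩
    · refine (hplane i _).2 ?_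
      -- The criterion sees only the value at `B i`, which g and μ_i P_{Ω_i} share, so the vanishing
      -- of f there gives the plane condition.
      rw [QuatPoly.rightEval_leftMinPoly_mul_eq_zero_iff hΛf (hαm _) (hA0 i) (hAu i), hμr]
      exact (QuatPoly.rightEval_leftMinPoly_mul_eq_zero_iff hΛf (hαm _) (hA0 i) (hAu i) g).1
        (hfr _ (hβm _))
    · simp only [mul_assoc]
      rw [← Finset.mul_sum, ← mul_add, ← hh, add_sub_cancel]
  · rintro ⟨μ, h, hm, rfl⟩
    constructor
    · intro a ha
      simp only [mul_assoc]
      rw [← Finset.mul_sum, ← mul_add]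
      exact QuatPoly.leftEval_leftMinPoly_mul hΛf ha _
    · intro b hb
      rw [QuatPoly.rightEval_add, QuatPoly.rightEval_mul_rightMinPoly hΩf hb, add_zero,
        QuatPoly.rightEval_sum]
      refine Finset.sum_eq_zero fun i _ => ?_
      by_cases hbi : b = B i
      · rw [hbi, mul_assoc]
        exact (hplane i _).1 (hm i)
      · exact QuatPoly.rightEval_mul_rightMinPoly (hΩf.subset Set.sdiff_subset) ⟨hb, hbi⟩ _
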